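/- Let $n\ge 3$, $1\le k\le n-1$, and let $p(z)=z^n+a_{n-1}z^{n-1}+\dots+a_1z+a_0$ be a polynomial with complex coefficients and $a_0\ne 0$. Put $$p_{n-k}(z)=z^{n-k}+a_{n-1}z^{n-k-1}+\dots+a_{k+1}z,\qquad P_{n-k}(x)=x^{n-k}+|a_{n-1}|x^{n-k-1}+\dots+|a_{k+1}|x,\qquad \mu(k,x)=\sum_{j=0}^{k-1}|a_j|x^{j-k}.$$ For $j=0,1,\dots,n-1$ the polynomial $$h_j(x)=x^n+|a_{n-1}|x^{n-1}+\dots+|a_{j+1}|x^{j+1}-|a_j|x^j-\dots-|a_0|$$ has a unique positive root; call it $s_j$. Then $P_{n-k}(s_k)=\mu(k,s_k)+|a_k|$ and $\mu(k,s_{k-1})=P_{n-k}(s_{k-1})+|a_k|$, and the following hold. (1) All the zeros of $p$ are contained in $\Upsilon_1(k)$ and also in $\Upsilon_2(k)$, where $$\Upsilon_1(k)=\{z\in\mathbb C: |p_{n-k}(z)|\le P_{n-k}(s_k)\},\qquad \Upsilon_2(k)=\{z\in\mathbb C: |p_{n-k}(z)+a_k|\le \mu(k,s_{k-1})\}.$$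 Each of these sets is the closed interior of a lemniscate, namely of $|p_{n-k}(z)|=P_{n-k}(s_k)$ and of $|p_{n-k}(z)+a_k|=\mu(k,s_{k-1})$ respectively. Here a lemniscate is a curve $|q(z)|=\alpha$ with $q$ a nonconstant polynomial and $\alpha>0$, its foci are the zeros of $q$, and its closed interior is the union of the curve and the bounded components of its complement. (2) Let $R$ be a connected component of $\Upsilon_1(k)$ or of $\Upsilon_2(k)$ whose boundary is a simple closed (Jordan) curve, and let $\ell$ be the number of foci of the corresponding lemniscate that are contained in $R$. Then $R$ contains exactly $\ell$ zeros of $p$ if $0\notin R$, and exactly $\ell+k$ zeros of $p$ if $0\in R$. Foci and zeros are counted with multiplicity. Moreover, $h_{n-1}(x)=x^n-|a_{n-1}|x^{n-1}-\dots-|a_1|x-|a_0|$ and $\Upsilon_1(n-1)=\{z\in\mathbb C:|z|\le s_{n-1}\}$, so that all zeros of $p$ lie in this disk, which is Cauchy's bound. -/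

import Mathlib

open Polynomial

namespace GenCauchy

/-- The associated polynomials of `p(z) = z^n + a_{n-1} z^{n-1} + ... + a_0`:
`p_1(z) = z` and `p_{j+1}(z) = z (p_j(z) + a_{n-j})` for `j ≥ 1`, so that
`p_j(z) = z^j + a_{n-1} z^{j-1} + ... + a_{n-j+1} z`. Only the indices `1 ≤ j ≤ n - 1` are
meaningful; the value at the index `0` is a convention. -/
noncomputable def assocPoly (p : ℂ[X]) : ℕ → ℂ[X]
  | 0 => 0
  | 1 => X
  | j + 2 => X * (assocPoly p (j + 1) + C (p.coeff (p.natDegree - (j + 1))))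

/-- The real polynomial obtained from `q` by replacing its coefficients with their moduli. -/
noncomputable def modulusPoly (q : ℂ[X]) : ℝ[X] :=
  ∑ i ∈ Finset.range (q.natDegree + 1), C ‖q.coeff i‖ * X ^ i

/-- `P_j`, the `j`-th associated polynomial of `p` with coefficients replaced by their moduli. -/
noncomputable def assocModPoly (p : ℂ[X]) (j : ℕ) : ℝ[X] :=
  modulusPoly (assocPoly p j)

/-- `μ(k, x) = ∑_{j = 0}^{k - 1} |a_j| x^(j - k)`, with (negative) integer exponents. -/
noncomputable def mu (p : ℂ[X]) (k : ℕ) (x : ℝ) : ℝ :=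
  ∑ j ∈ Finset.range k, ‖p.coeff j‖ * x ^ ((j : ℤ) - (k : ℤ))

/-- `h_j(x) = x^n + |a_{n-1}| x^{n-1} + ... + |a_{j+1}| x^{j+1} - |a_j| x^j - ... - |a_0|`,
where `n` is the degree of `p`. -/
noncomputable def cauchyFun (p : ℂ[X]) (j : ℕ) (x : ℝ) : ℝ :=
  x ^ p.natDegree + ∑ i ∈ Finset.Ioo j p.natDegree, ‖p.coeff i‖ * x ^ i
    - ∑ i ∈ Finset.range (j + 1), ‖p.coeff i‖ * x ^ i

/-- `{z : |p_{n-k}(z)| ≤ P_{n-k}(x)}`; the set `Υ₁(k)` is the case `x = s_k`. -/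
def upsilonOne (p : ℂ[X]) (k : ℕ) (x : ℝ) : Set ℂ :=
  {z | ‖(assocPoly p (p.natDegree - k)).eval z‖ ≤ (assocModPoly p (p.natDegree - k)).eval x}

/-- `{z : |p_{n-k}(z) + a_k| ≤ μ(k, x)}`; the set `Υ₂(k)` is the case `x = s_{k-1}`. -/
def upsilonTwo (p : ℂ[X]) (k : ℕ) (x : ℝ) : Set ℂ :=
  {z | ‖(assocPoly p (p.natDegree - k)).eval z + p.coeff k‖ ≤ mu p k x}

/-- The level curve `|q(z)| = α`. It is a lemniscate when `q` is nonconstant and `α > 0`; its foci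
are the zeros of `q`. -/
def lemniscate (q : ℂ[X]) (α : ℝ) : Set ℂ :=
  {z | ‖q.eval z‖ = α}

/-- The closed interior of a set `L` in the plane: the points of `L` together with the points lying
in a bounded connected component of the complement of `L`. -/
def closedInterior (L : Set ℂ) : Set ℂ :=
  {z | z ∈ L ∨ (z ∉ L ∧ Bornology.IsBounded (connectedComponentIn Lᶜ z))}

/-- `S` is the closed interior of the (nondegenerate) lemniscate `|q(z)| = α`. -/
def IsClosedInteriorOfLemniscate (S : Set ℂ) (q : ℂ[X]) (α : ℝ) : Prop :=
  0 < q.natDegree ∧ 0 < α ∧ S = closedInterior (lemniscate q α)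

/-- A simple closed (Jordan) curve: an injective continuous image of the unit circle. -/
def IsJordanCurve (J : Set ℂ) : Prop :=
  ∃ γ : Circle → ℂ, Continuous γ ∧ Function.Injective γ ∧ Set.range γ = J

/-- `R` is a connected component of `S`. -/
def IsComponentOf (R S : Set ℂ) : Prop :=
  ∃ z ∈ S, R = connectedComponentIn S z

open Classical in
/-- The number of zeros of `q` in `S`, counted with multiplicity. -/
noncomputable def numZerosIn (q : ℂ[X]) (S : Set ℂ) : ℕ :=
  q.roots.countP (fun z => z ∈ S)

end GenCauchy

open GenCauchy

namespace GenCauchy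

/-! Write `p = X ^ k * q + r`, where `q` is `p_{n-k}` or `p_{n-k} + a_k` and `r` collects the
remaining low terms. Let `s` be the matching positive root and `α` the level. Dividing `h_j(s) = 0`
by `s ^ k` gives the two expressions for `α`: one bounds `|q|` for `|z| ≤ s` by the triangle
inequality, the other bounds `|r(z)|` by `|z|^k α` for `|z| ≥ s`, since `μ` decreases. Hence every
zero of `X ^ k * q + t r`, `0 ≤ t ≤ 1`, lies in `{|q| ≤ α}` (`norm_eval_le_of_isRoot`), and `t = 1`
locates the zeros of `p`.

For the count, the homotopy runs from `X ^ k * q`, whose zeros are the foci and `k` copies of `0`,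
to `p`. A component of the compact sublevel set agrees, on the finitely many zeros at both ends,
with a piece of a splitting into two disjoint compact sets (`exists_isCompact_separation`). No zero
can pass between the pieces (`numZerosIn_eq_of_family`). -/

lemma numZerosIn_mul {f g : ℂ[X]} (hf : f ≠ 0) (hg : g ≠ 0) (S : Set ℂ) :
    numZerosIn (f * g) S = numZerosIn f S + numZerosIn g S := by
  simp only [numZerosIn, roots_mul (mul_ne_zero hf hg), Multiset.countP_add]

lemma numZerosIn_X_pow_of_mem (k : ℕ) {S : Set ℂ} (h : (0 : ℂ) ∈ S) :
    numZerosIn (X ^ k) S = k := by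
  simp [numZerosIn, Multiset.countP_nsmul, ← Multiset.cons_zero, h]

lemma numZerosIn_X_pow_of_notMem (k : ℕ) {S : Set ℂ} (h : (0 : ℂ) ∉ S) :
    numZerosIn (X ^ k) S = 0 := by
  simp [numZerosIn, Multiset.countP_nsmul, ← Multiset.cons_zero, h]

lemma numZerosIn_congr {f : ℂ[X]} {S T : Set ℂ} (h : ∀ z ∈ f.roots, z ∈ S ↔ z ∈ T) :
    numZerosIn f S = numZerosIn f T := by
  classical
  simp only [numZerosIn]
  exact Multiset.countP_congr rfl fun z hz => by simpa using h z hz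

open Classical in
lemma numZerosIn_prod_X_sub_C {ι : Type*} [Fintype ι] (v : ι → ℂ) (S : Set ℂ) :
    numZerosIn (∏ i, (X - C (v i))) S = (Finset.univ.filter fun i => v i ∈ S).card := by
  have : (∏ i, (X - C (v i))).roots = Finset.univ.val.map v := by
    have := roots_multiset_prod_X_sub_C (Finset.univ.val.map v)
    rwa [Multiset.map_map] at this
  rw [numZerosIn, this, Multiset.countP_map]
  rfl

lemma exists_eq_prod_X_sub_C {f : ℂ[X]} (hf : f.Monic) {n : ℕ} (hn : f.natDegree = n) :
    ∃ v : Fin n → ℂ, f = ∏ i, (X - C (v i)) := by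
  have hs := IsAlgClosed.splits f
  have hc : f.roots.toList.length = n := by
    rw [Multiset.length_toList, ← hs.natDegree_eq_card_roots, hn]
  subst hc
  refine ⟨fun i => f.roots.toList.get i, ?_⟩
  conv_lhs => rw [hs.eq_prod_roots_of_monic hf]
  rw [← List.prod_ofFn]
  simp only [List.get_eq_getElem]
  rw [List.ofFn_getElem_eq_map f.roots.toList fun x => X - C x, ← Multiset.prod_coe,
    ← Multiset.map_coe, Multiset.coe_toList]

/-! ### Zero counts along a homotopy -/

/-- If the zeros of a continuous family of monic polynomials of fixed degree stay in the union of
two disjoint compact sets, then the numbers of zeros in these sets are constant. -/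
lemma numZerosIn_eq_of_family {U W : Set ℂ} (hU : IsCompact U) (hW : IsCompact W)
    (hUW : Disjoint U W) {n : ℕ} (f : ℝ → ℂ[X]) (hm : ∀ t, (f t).Monic)
    (hd : ∀ t, (f t).natDegree = n) (hcont : ∀ x, Continuous fun t => (f t).eval x)
    (hroots : ∀ t ∈ Set.Icc (0 : ℝ) 1, ∀ z, (f t).IsRoot z → z ∈ U ∪ W) :
    numZerosIn (f 0) U = numZerosIn (f 1) U := by
  classical
  -- Pairs of a time and an ordered list of the zeros, with `S` marking the entries in `U`.
  -- Compactness of these sets makes their projections to the time axis closed, so the level sets of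
  -- the count are closed.
  let K (S : Finset (Fin n)) : Set (ℝ × (Fin n → ℂ)) :=
    (Set.Icc (0 : ℝ) 1 ×ˢ Set.univ.pi fun i => if i ∈ S then U else W) ∩
      {x | ∀ z, (f x.1).eval z = ∏ i, (z - x.2 i)}
  have hK : ∀ S, IsCompact (K S) := by
    intro S
    refine (isCompact_Icc.prod (isCompact_univ_pi fun i => ?_)).inter_right ?_
    · split_ifs <;> assumption
    · rw [Set.ofPred_forall]
      refine isClosed_iInter fun z => isClosed_eq ((hcont z).comp continuous_fst) ?_
      fun_prop
  have hfib : ∀ c : ℕ, {t : ℝ | t ∈ Set.Icc (0 : ℝ) 1 ∧ numZerosIn (f t) U = c} =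
      ⋃ S ∈ (Finset.univ.filter fun S : Finset (Fin n) => S.card = c), Prod.fst '' K S := by
    intro c
    ext t
    simp only [Set.mem_ofPred_eq, Set.mem_iUnion, Finset.mem_filter, Finset.mem_univ, true_and,
      Set.mem_image, exists_prop]
    constructor
    · rintro ⟨ht, hc⟩
      obtain ⟨v, hv⟩ := exists_eq_prod_X_sub_C (hm t) (hd t)
      refine ⟨Finset.univ.filter fun i => v i ∈ U, ?_, (t, v), ⟨⟨ht, ?_⟩, ?_⟩, rfl⟩
      · rw [← hc, hv, numZerosIn_prod_X_sub_C]
      · intro i _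
        have : v i ∈ U ∪ W := by
          refine hroots t ht _ ?_
          rw [IsRoot, hv, eval_prod]
          exact Finset.prod_eq_zero (Finset.mem_univ i) (by simp)
        by_cases h : v i ∈ U
        · simp [h]
        · simpa [h] using this.resolve_left h
      · intro z
        simp [hv, eval_prod]
    · rintro ⟨S, hS, ⟨t', v⟩, ⟨⟨ht, hv⟩, he⟩, rfl⟩
      refine ⟨ht, ?_⟩
      have : f t' = ∏ i, (X - C (v i)) := by
        refine Polynomial.funext fun z => ?_
        rw [he z]
        simp [eval_prod]
      show numZerosIn (f t') U = c
      rw [this, numZerosIn_prod_X_sub_C, ← hS]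
      congr 1
      ext i
      have hi := hv i (Set.mem_univ i)
      by_cases h : i ∈ S
      · simpa [h] using hi
      · have : v i ∈ W := by simpa [h] using hi
        simpa [h] using fun hiU => Set.disjoint_left.1 hUW hiU this
  have hclosed : ∀ c : ℕ, IsClosed {t : ℝ | t ∈ Set.Icc (0 : ℝ) 1 ∧ numZerosIn (f t) U = c} := by
    intro c
    rw [hfib c]
    exact isClosed_biUnion_finset fun S _ => ((hK S).image continuous_fst).isClosed
  have hle : ∀ t, numZerosIn (f t) U ≤ n := fun t =>
    (Multiset.countP_le_card _ _).trans ((card_roots' _).trans (hd t).le)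
  -- The count takes finitely many values, each on a closed set, so it is continuous into a discrete
  -- space.
  have hN : Continuous fun t : Set.Icc (0 : ℝ) 1 => numZerosIn (f t) U := by
    refine continuous_iff_isClosed.2 fun s _ => ?_
    have : (fun t : Set.Icc (0 : ℝ) 1 => numZerosIn (f t) U) ⁻¹' s =
        ⋃ c ∈ (Finset.range (n + 1)).filter (· ∈ s), Subtype.val ⁻¹'
          {t : ℝ | t ∈ Set.Icc (0 : ℝ) 1 ∧ numZerosIn (f t) U = c} := by
      ext t
      have := hle t
      have := t.2
      simp only [Set.mem_preimage, Set.mem_iUnion, Finset.mem_filter, Finset.mem_range,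
        Set.mem_ofPred_eq, exists_prop]
      constructor
      · intro h
        exact ⟨_, ⟨by omega, h⟩, t.2, rfl⟩
      · rintro ⟨c, ⟨_, h⟩, _, rfl⟩
        exact h
    rw [this]
    exact isClosed_biUnion_finset fun c _ => (hclosed c).preimage continuous_subtype_val
  have : PreconnectedSpace (Set.Icc (0 : ℝ) 1) :=
    Subtype.preconnectedSpace isPreconnected_Icc
  exact PreconnectedSpace.constant this hN (x := ⟨0, by simp⟩) (y := ⟨1, by simp⟩)

/-- A component of a compact set can be separated from finitely many points of its complement. -/
lemma exists_isCompact_separation {K : Set ℂ} (hK : IsCompact K) {z : ℂ} (hz : z ∈ K)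
    (F : Finset ℂ) : ∃ U W : Set ℂ, IsCompact U ∧ IsCompact W ∧ Disjoint U W ∧ U ∪ W = K ∧
      ∀ w ∈ F, w ∈ U ↔ w ∈ connectedComponentIn K z := by
  classical
  have : CompactSpace K := isCompact_iff_compactSpace.1 hK
  have key : ∀ w : K, w ∉ connectedComponent (⟨z, hz⟩ : K) →
      ∃ V : Set K, IsClopen V ∧ (⟨z, hz⟩ : K) ∈ V ∧ w ∉ V := by
    intro w hw
    -- In a compact Hausdorff space a component is the intersection of the clopen sets containing
    -- it; finitely many of these exclude finitely many points.
    rw [connectedComponent_eq_iInter_isClopen] at hw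
    simp only [Set.mem_iInter, not_forall] at hw
    obtain ⟨V, hV⟩ := hw
    exact ⟨V, V.2.1, V.2.2, hV⟩
  choose! V hV1 hV2 hV3 using key
  let G : Finset K := (F.preimage Subtype.val Subtype.val_injective.injOn).filter
    fun w => w ∉ connectedComponent (⟨z, hz⟩ : K)
  let V' : Set K := ⋂ w ∈ G, V w
  have hG : ∀ w ∈ G, w ∉ connectedComponent (⟨z, hz⟩ : K) := fun w hw => (Finset.mem_filter.1 hw).2
  have hV' : IsClopen V' := isClopen_biInter_finset fun w hw => hV1 w (hG w hw)
  have hzV' : (⟨z, hz⟩ : K) ∈ V' := Set.mem_iInter₂.2 fun w hw => hV2 w (hG w hw)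
  refine ⟨Subtype.val '' V', Subtype.val '' V'ᶜ, hV'.1.isCompact.image continuous_subtype_val,
    hV'.compl.1.isCompact.image continuous_subtype_val, ?_, ?_, ?_⟩
  · exact (Set.disjoint_image_iff Subtype.val_injective).2 disjoint_compl_right
  · rw [← Set.image_union, Set.union_compl_self, Set.image_univ, Subtype.range_coe]
  · intro w hw
    rw [connectedComponentIn_eq_image hz]
    constructor
    · rintro ⟨w, hwV, rfl⟩
      refine ⟨w, ?_, rfl⟩
      by_contra hc
      have hwG : w ∈ G := Finset.mem_filter.2 ⟨Finset.mem_preimage.2 hw, hc⟩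
      exact hV3 w hc (Set.mem_iInter₂.1 hwV w hwG)
    · rintro ⟨w, hwV, rfl⟩
      exact ⟨w, hV'.connectedComponent_subset hzV' hwV, rfl⟩

/-! ### Polynomial sublevel sets and lemniscates -/

lemma isBounded_norm_eval_le {q : ℂ[X]} (hq : 0 < q.natDegree) (α : ℝ) :
    Bornology.IsBounded {z : ℂ | ‖q.eval z‖ ≤ α} := by
  have h := q.tendsto_norm_atTop (natDegree_pos_iff_degree_pos.1 hq)
    (tendsto_norm_cocompact_atTop (E := ℂ))
  have := h.eventually_gt_atTop α
  rw [← Metric.cobounded_eq_cocompact] at this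
  exact Bornology.isBounded_def.2 (Filter.mem_of_superset this fun z hz hz' =>
    absurd (show ‖q.eval z‖ ≤ α from hz') (not_le.2 hz))

lemma isCompact_norm_eval_le {q : ℂ[X]} (hq : 0 < q.natDegree) (α : ℝ) :
    IsCompact {z : ℂ | ‖q.eval z‖ ≤ α} :=
  Metric.isCompact_of_isClosed_isBounded
    (isClosed_le q.continuous.norm continuous_const) (isBounded_norm_eval_le hq α)

/-- A connected set avoiding the level `α` cannot leave `{|q| < α}`, which is bounded; conversely,
the maximum principle bounds `|q|` by `α` on a bounded complementary component. -/
lemma isClosedInteriorOfLemniscate_norm_eval_le {q : ℂ[X]} (hq : 0 < q.natDegree) {α : ℝ}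
    (hα : 0 < α) : IsClosedInteriorOfLemniscate {z : ℂ | ‖q.eval z‖ ≤ α} q α := by
  refine ⟨hq, hα, ?_⟩
  have hL : IsClosed (lemniscate q α) := isClosed_eq q.continuous.norm continuous_const
  ext z
  simp only [closedInterior, Set.mem_ofPred_eq]
  constructor
  · intro hz
    rcases hz.eq_or_lt with h | h
    · exact Or.inl h
    · have hzL : z ∉ lemniscate q α := fun h' => h.ne h'
      refine Or.inr ⟨hzL, (isBounded_norm_eval_le hq α).subset fun w hw => ?_⟩
      by_contra hc
      obtain ⟨y, hy, hyα⟩ := (isPreconnected_connectedComponentIn (x := z)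
        (F := (lemniscate q α)ᶜ)).intermediate_value (mem_connectedComponentIn hzL) hw
        q.continuous.norm.continuousOn ⟨h.le, (not_le.1 hc).le⟩
      exact connectedComponentIn_subset _ _ hy hyα
  · rintro (h | ⟨hzL, hb⟩)
    · exact h.le
    · set V := connectedComponentIn (lemniscate q α)ᶜ z with hV
      have hVo : IsOpen V := hL.isOpen_compl.connectedComponentIn
      refine Complex.norm_le_of_forall_mem_frontier_norm_le hb
        (f := fun w => q.eval w) q.differentiable.diffContOnCl (fun w hw => ?_)
        (subset_closure (mem_connectedComponentIn hzL))
      -- A frontier point off the lemniscate has an open component that meets `V`, hence equals `V`,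
      -- and so would be interior to `V`.
      by_contra hc
      have hwL : w ∈ (lemniscate q α)ᶜ := fun h => hc (le_of_eq h)
      obtain ⟨y, hyw, hyz⟩ := mem_closure_iff.1 hw.1 _
        (hL.isOpen_compl.connectedComponentIn (x := w)) (mem_connectedComponentIn hwL)
      have hwV : w ∈ V := by
        rw [hV, connectedComponentIn_eq hyz, ← connectedComponentIn_eq hyw]
        exact mem_connectedComponentIn hwL
      exact hw.2 (hVo.interior_eq.symm ▸ hwV)

/-- If `q` is bounded by `α` on the disk of radius `s` and `r` is dominated by `α |z|^k` off that
disk, then the zeros of `X ^ k * q + t r` lie in `{|q| ≤ α}` for `0 ≤ t ≤ 1`. -/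
lemma norm_eval_le_of_isRoot {q r : ℂ[X]} {k : ℕ} {s α t : ℝ} (hs : 0 < s)
    (hq : ∀ z, ‖z‖ ≤ s → ‖q.eval z‖ ≤ α) (hr : ∀ z, s ≤ ‖z‖ → ‖r.eval z‖ ≤ ‖z‖ ^ k * α)
    (ht : t ∈ Set.Icc (0 : ℝ) 1) {z : ℂ} (hz : (X ^ k * q + C (t : ℂ) * r).IsRoot z) :
    ‖q.eval z‖ ≤ α := by
  rcases le_total ‖z‖ s with h | h
  · exact hq z h
  · have hz' : z ^ k * q.eval z = -(t * r.eval z) := by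
      have := hz
      simp only [IsRoot, eval_add, eval_mul, eval_pow, eval_X, eval_C] at this
      exact eq_neg_of_add_eq_zero_left this
    have h1 : ‖z‖ ^ k * ‖q.eval z‖ = t * ‖r.eval z‖ := by
      rw [← norm_pow, ← norm_mul, hz', norm_neg, norm_mul, Complex.norm_real,
        Real.norm_of_nonneg ht.1]
    have h2 : t * ‖r.eval z‖ ≤ ‖r.eval z‖ := mul_le_of_le_one_left (norm_nonneg _) ht.2
    exact le_of_mul_le_mul_left (by linarith [hr z h]) (pow_pos (hs.trans_le h) k)

/-- The degree bound on `r` keeps the whole homotopy monic of constant degree, so no zero escapes to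
infinity. -/
lemma numZerosIn_component {q r : ℂ[X]} {k : ℕ} {s α : ℝ} (hs : 0 < s)
    (hqm : q.Monic) (hqd : 0 < q.natDegree) (hrd : r.degree < (X ^ k * q).degree)
    (hq : ∀ z, ‖z‖ ≤ s → ‖q.eval z‖ ≤ α) (hr : ∀ z, s ≤ ‖z‖ → ‖r.eval z‖ ≤ ‖z‖ ^ k * α)
    {R : Set ℂ} (hR : IsComponentOf R {z | ‖q.eval z‖ ≤ α}) :
    ((0 : ℂ) ∉ R → numZerosIn (X ^ k * q + r) R = numZerosIn q R) ∧
      ((0 : ℂ) ∈ R → numZerosIn (X ^ k * q + r) R = numZerosIn q R + k) := by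
  classical
  obtain ⟨z, hz, rfl⟩ := hR
  obtain ⟨U, W, hU, hW, hUW, hUWK, hF⟩ := exists_isCompact_separation
    (isCompact_norm_eval_le hqd α) hz ((X ^ k * q).roots.toFinset ∪ (X ^ k * q + r).roots.toFinset)
  have hAm : (X ^ k * q).Monic := (monic_X_pow k).mul hqm
  have hlt : ∀ t : ℝ, (C (t : ℂ) * r).degree < (X ^ k * q).degree := fun t => by
    refine lt_of_le_of_lt ?_ hrd
    rw [← smul_eq_C_mul]
    exact degree_smul_le _ _
  have h := numZerosIn_eq_of_family hU hW hUW (fun t : ℝ => X ^ k * q + C (t : ℂ) * r)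
    (fun t => hAm.add_of_left (hlt t))
    (fun t => natDegree_eq_natDegree (degree_add_eq_left_of_degree_lt (hlt t)))
    (fun x => by
      simp only [eval_add, eval_mul, eval_C]
      fun_prop)
    (fun t ht w hw => by
      rw [hUWK]
      exact norm_eval_le_of_isRoot hs hq hr ht hw)
  simp only [Complex.ofReal_zero, C_0, zero_mul, add_zero, Complex.ofReal_one, C_1, one_mul] at h
  rw [numZerosIn_congr fun w hw => hF w (by simp [Multiset.mem_toFinset, hw]),
    numZerosIn_congr fun w hw => hF w (Finset.mem_union_right _ (Multiset.mem_toFinset.2 hw)),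
    numZerosIn_mul (monic_X_pow k).ne_zero hqm.ne_zero] at h
  refine ⟨fun h0 => ?_, fun h0 => ?_⟩
  · rw [← h, numZerosIn_X_pow_of_notMem k h0, zero_add]
  · rw [← h, numZerosIn_X_pow_of_mem k h0, add_comm]

/-! ### Associated polynomials and their moduli -/

lemma coeff_assocPoly {p : ℂ[X]} (hp : p.Monic) {j : ℕ} (hj : 1 ≤ j) (hjn : j ≤ p.natDegree)
    (i : ℕ) : (assocPoly p j).coeff i = if i = 0 then 0 else p.coeff (p.natDegree - j + i) := by
  induction j, hj using Nat.le_induction generalizing i with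
  | base =>
    show (X : ℂ[X]).coeff i = _
    rw [coeff_X]
    rcases i with _ | _ | i
    · simp
    · rw [show p.natDegree - 1 + (0 + 1) = p.natDegree by omega]
      simp [hp.coeff_natDegree]
    · rw [coeff_eq_zero_of_natDegree_lt (p := p) (by omega)]
      simp
  | succ j hj ih =>
    obtain ⟨j, rfl⟩ : ∃ m, j = m + 1 := ⟨j - 1, by omega⟩
    show (X * (assocPoly p (j + 1) + C (p.coeff (p.natDegree - (j + 1))))).coeff i = _
    rcases i with _ | i
    · simp
    · rw [coeff_X_mul, coeff_add, ih (by omega), coeff_C]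
      rcases i with _ | i
      · rw [show p.natDegree - (j + 1) = p.natDegree - (j + 1 + 1) + (0 + 1) by omega]
        simp
      · rw [show p.natDegree - (j + 1) + (i + 1) = p.natDegree - (j + 1 + 1) + (i + 1 + 1) by omega]
        simp

lemma natDegree_assocPoly {p : ℂ[X]} (hp : p.Monic) {j : ℕ} (hj : 1 ≤ j)
    (hjn : j ≤ p.natDegree) : (assocPoly p j).natDegree = j := by
  refine natDegree_eq_of_le_of_coeff_ne_zero (natDegree_le_iff_coeff_eq_zero.2 fun i hi => ?_) ?_
  · rw [coeff_assocPoly hp hj hjn, if_neg (by omega)]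
    exact coeff_eq_zero_of_natDegree_lt (by omega)
  · rw [coeff_assocPoly hp hj hjn, if_neg (by omega), Nat.sub_add_cancel hjn, hp.coeff_natDegree]
    exact one_ne_zero

lemma monic_assocPoly {p : ℂ[X]} (hp : p.Monic) {j : ℕ} (hj : 1 ≤ j)
    (hjn : j ≤ p.natDegree) : (assocPoly p j).Monic := by
  rw [Monic, leadingCoeff, natDegree_assocPoly hp hj hjn, coeff_assocPoly hp hj hjn,
    if_neg (by omega), Nat.sub_add_cancel hjn, hp.coeff_natDegree]

lemma eval_modulusPoly (q : ℂ[X]) (x : ℝ) :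
    (modulusPoly q).eval x = ∑ i ∈ Finset.range (q.natDegree + 1), ‖q.coeff i‖ * x ^ i := by
  simp [modulusPoly, eval_finsetSum]

lemma norm_eval_le_eval_modulusPoly (q : ℂ[X]) (z : ℂ) :
    ‖q.eval z‖ ≤ (modulusPoly q).eval ‖z‖ := by
  rw [eval_modulusPoly, eval_eq_sum_range]
  exact (norm_sum_le _ _).trans_eq (Finset.sum_congr rfl fun i _ => by rw [norm_mul, norm_pow])

lemma eval_modulusPoly_mono (q : ℂ[X]) {x y : ℝ} (hx : 0 ≤ x) (hxy : x ≤ y) :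
    (modulusPoly q).eval x ≤ (modulusPoly q).eval y := by
  rw [eval_modulusPoly, eval_modulusPoly]
  gcongr

lemma eval_modulusPoly_pos {q : ℂ[X]} (hq : q ≠ 0) {x : ℝ} (hx : 0 < x) :
    0 < (modulusPoly q).eval x := by
  rw [eval_modulusPoly]
  refine Finset.sum_pos' (fun i _ => by positivity) ⟨q.natDegree, by simp, ?_⟩
  have : 0 < ‖q.coeff q.natDegree‖ := norm_pos_iff.2 (by simpa using hq)
  positivity

lemma pow_mul_eval_assocModPoly {p : ℂ[X]} (hp : p.Monic) {k : ℕ} (hk : k < p.natDegree)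
    (x : ℝ) : x ^ k * (assocModPoly p (p.natDegree - k)).eval x =
      x ^ p.natDegree + ∑ i ∈ Finset.Ioo k p.natDegree, ‖p.coeff i‖ * x ^ i := by
  have h1 : 1 ≤ p.natDegree - k := by omega
  have h2 : p.natDegree - k ≤ p.natDegree := by omega
  have h3 : ∑ i ∈ Finset.Ico (k + 1) (p.natDegree + 1), ‖p.coeff i‖ * x ^ i =
      x ^ p.natDegree + ∑ i ∈ Finset.Ioo k p.natDegree, ‖p.coeff i‖ * x ^ i := by
    rw [Finset.sum_Ico_succ_top (by omega), hp.coeff_natDegree, norm_one, one_mul, add_comm]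
    rfl
  rw [assocModPoly, eval_modulusPoly, natDegree_assocPoly hp h1 h2, Finset.sum_range_succ',
    ← h3, Finset.sum_Ico_eq_sum_range, show p.natDegree + 1 - (k + 1) = p.natDegree - k by omega,
    mul_add, Finset.mul_sum]
  simp only [coeff_assocPoly hp h1 h2]
  simp only [if_true, norm_zero, zero_mul, mul_zero, add_zero]
  refine Finset.sum_congr rfl fun i _ => ?_
  rw [if_neg (by omega), show p.natDegree - (p.natDegree - k) + (i + 1) = k + 1 + i by omega]
  ring

/-! ### The functions `μ` and `h_j` -/

lemma pow_mul_mu (p : ℂ[X]) (k : ℕ) {x : ℝ} (hx : x ≠ 0) :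
    x ^ k * mu p k x = ∑ i ∈ Finset.range k, ‖p.coeff i‖ * x ^ i := by
  rw [mu, Finset.mul_sum]
  refine Finset.sum_congr rfl fun i _ => ?_
  rw [zpow_sub₀ hx, zpow_natCast, zpow_natCast]
  field_simp

lemma mu_anti (p : ℂ[X]) (k : ℕ) {x y : ℝ} (hx : 0 < x) (hxy : x ≤ y) : mu p k y ≤ mu p k x := by
  refine Finset.sum_le_sum fun i hi => mul_le_mul_of_nonneg_left ?_ (norm_nonneg _)
  have hik := Finset.mem_range.1 hi
  rw [show (i : ℤ) - k = -((k - i : ℕ) : ℤ) by omega, zpow_neg, zpow_neg, zpow_natCast,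
    zpow_natCast]
  gcongr

lemma mu_pos {p : ℂ[X]} (h0 : p.coeff 0 ≠ 0) {k : ℕ} (hk : 1 ≤ k) {x : ℝ} (hx : 0 < x) :
    0 < mu p k x := by
  refine Finset.sum_pos' (fun i _ => by positivity) ⟨0, Finset.mem_range.2 hk, ?_⟩
  have := norm_pos_iff.2 h0
  positivity

/-- This form turns the root equation into an equality of levels and separates an increasing term
from a nonincreasing one, which gives uniqueness of the root. -/
lemma cauchyFun_eq {p : ℂ[X]} (hp : p.Monic) {k : ℕ} (hk : k < p.natDegree) {x : ℝ}
    (hx : x ≠ 0) : cauchyFun p k x =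
      x ^ k * ((assocModPoly p (p.natDegree - k)).eval x - (mu p k x + ‖p.coeff k‖)) := by
  rw [mul_sub, mul_add, pow_mul_eval_assocModPoly hp hk, pow_mul_mu p k hx, cauchyFun,
    Finset.sum_range_succ]
  ring

lemma cauchyFun_pred_eq {p : ℂ[X]} (hp : p.Monic) {k : ℕ} (hk1 : 1 ≤ k) (hk : k < p.natDegree)
    {x : ℝ} (hx : x ≠ 0) : cauchyFun p (k - 1) x =
      x ^ k * ((assocModPoly p (p.natDegree - k)).eval x + ‖p.coeff k‖ - mu p k x) := by
  obtain ⟨k, rfl⟩ : ∃ m, k = m + 1 := ⟨k - 1, by omega⟩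
  have : ∑ i ∈ Finset.Ioo k p.natDegree, ‖p.coeff i‖ * x ^ i = ‖p.coeff (k + 1)‖ * x ^ (k + 1) +
      ∑ i ∈ Finset.Ioo (k + 1) p.natDegree, ‖p.coeff i‖ * x ^ i := by
    exact Finset.sum_eq_sum_Ico_succ_bot hk _
  rw [mul_sub, mul_add, pow_mul_eval_assocModPoly hp hk, pow_mul_mu p _ hx, cauchyFun,
    Nat.add_sub_cancel, this]
  ring

lemma continuous_cauchyFun (p : ℂ[X]) (j : ℕ) : Continuous (cauchyFun p j) := by
  unfold cauchyFun
  fun_prop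

lemma existsUnique_pos_cauchyFun_eq_zero {p : ℂ[X]} (hp : p.Monic) (h0 : p.coeff 0 ≠ 0) {j : ℕ}
    (hj : j < p.natDegree) : ∃! x : ℝ, 0 < x ∧ cauchyFun p j x = 0 := by
  have hneg : cauchyFun p j 0 < 0 := by
    have hI : ∑ i ∈ Finset.Ioo j p.natDegree, ‖p.coeff i‖ * (0 : ℝ) ^ i = 0 :=
      Finset.sum_eq_zero fun i hi => by
        rw [zero_pow (by have := (Finset.mem_Ioo.1 hi).1; omega), mul_zero]
    rw [cauchyFun, hI, zero_pow (by omega), Finset.sum_range_succ',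
      Finset.sum_eq_zero fun i _ => by rw [zero_pow (by omega), mul_zero]]
    simpa using h0
  -- At `1 + M` the negative terms sum to at most `M (1 + M)^(n-1) ≤ (1 + M)^n`, so `h_j` is
  -- nonnegative there.
  set M : ℝ := ∑ i ∈ Finset.range (j + 1), ‖p.coeff i‖ with hM
  have hM0 : 0 ≤ M := by positivity
  have hpos : 0 ≤ cauchyFun p j (1 + M) := by
    have h1 : ∑ i ∈ Finset.range (j + 1), ‖p.coeff i‖ * (1 + M) ^ i ≤
        M * (1 + M) ^ (p.natDegree - 1) := by
      rw [hM, Finset.sum_mul, ← hM]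
      refine Finset.sum_le_sum fun i hi => mul_le_mul_of_nonneg_left ?_ (norm_nonneg _)
      exact pow_le_pow_right₀ (by linarith) (by have := Finset.mem_range.1 hi; omega)
    have h2 : M * (1 + M) ^ (p.natDegree - 1) ≤ (1 + M) ^ p.natDegree := by
      obtain ⟨m, hm⟩ : ∃ m, p.natDegree = m + 1 := ⟨p.natDegree - 1, by omega⟩
      rw [hm, Nat.add_sub_cancel, pow_succ']
      gcongr
      linarith
    have h3 : 0 ≤ ∑ i ∈ Finset.Ioo j p.natDegree, ‖p.coeff i‖ * (1 + M) ^ i := by positivity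
    rw [cauchyFun]
    linarith
  obtain ⟨x, hx, hx0⟩ := intermediate_value_Icc (by linarith : (0 : ℝ) ≤ 1 + M)
    (continuous_cauchyFun p j).continuousOn ⟨hneg.le, hpos⟩
  have hxpos : 0 < x := lt_of_le_of_ne hx.1 fun h => by
    rw [← h] at hx0
    exact hneg.ne hx0
  have key : ∀ a b : ℝ, 0 < a → a < b → cauchyFun p j a = 0 → cauchyFun p j b ≠ 0 := by
    intro a b ha hab hfa hfb
    have hb := ha.trans hab
    have h1 : 0 < p.natDegree - j := by omega
    rw [cauchyFun_eq hp hj ha.ne', mul_eq_zero, or_iff_right (pow_pos ha _).ne'] at hfa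
    rw [cauchyFun_eq hp hj hb.ne', mul_eq_zero, or_iff_right (pow_pos hb _).ne'] at hfb
    have h2 := mu_anti p j ha hab.le
    have h3 : (assocModPoly p (p.natDegree - j)).eval a <
        (assocModPoly p (p.natDegree - j)).eval b := by
      rw [assocModPoly, eval_modulusPoly, eval_modulusPoly]
      -- Strictness comes from the leading term, whose coefficient is `1`.
      refine Finset.sum_lt_sum (fun i _ => by gcongr) ⟨p.natDegree - j, ?_, ?_⟩
      · rw [natDegree_assocPoly hp h1 (by omega)]
        simp
      · have := (monic_assocPoly hp h1 (by omega)).coeff_natDegree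
        rw [natDegree_assocPoly hp h1 (by omega)] at this
        rw [this, norm_one, one_mul, one_mul]
        exact pow_lt_pow_left₀ hab ha.le h1.ne'
    linarith
  refine ⟨x, ⟨hxpos, hx0⟩, fun y ⟨hy, hy0⟩ => ?_⟩
  rcases lt_trichotomy y x with h | h | h
  · exact absurd hx0 (key y x hy h hy0)
  · exact h
  · exact absurd hy0 (key x y hxpos h hx0)

/-! ### Splitting `p`, and the main theorem -/

lemma eq_X_pow_mul_assocPoly_add {p : ℂ[X]} (hp : p.Monic) {k : ℕ} (hk : k < p.natDegree) :
    p = X ^ k * assocPoly p (p.natDegree - k) +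
      ∑ i ∈ Finset.range (k + 1), C (p.coeff i) * X ^ i := by
  ext m
  simp only [coeff_add, coeff_X_pow_mul', finsetSum_coeff, coeff_C_mul_X_pow,
    coeff_assocPoly hp (show 1 ≤ p.natDegree - k by omega) (Nat.sub_le _ _)]
  rw [Finset.sum_ite_eq]
  rcases lt_trichotomy m k with h | rfl | h
  · rw [if_neg (by omega), if_pos (Finset.mem_range.2 (by omega)), zero_add]
  · simp
  · rw [if_pos h.le, if_neg (by omega), if_neg (by simp; omega), add_zero]
    congr 1
    omega

lemma degree_sum_range_lt (a : ℕ → ℂ) {k n : ℕ} (hk : k ≤ n) :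
    (∑ i ∈ Finset.range k, C (a i) * X ^ i : ℂ[X]).degree < n :=
  degree_lt_iff_coeff_zero _ _ |>.2 fun m hm => by
    simp only [finsetSum_coeff, coeff_C_mul_X_pow]
    rw [Finset.sum_ite_eq, if_neg (by simp; omega)]

lemma norm_eval_sum_range_le (p : ℂ[X]) (k : ℕ) {z : ℂ} (hz : z ≠ 0) :
    ‖(∑ i ∈ Finset.range k, C (p.coeff i) * X ^ i : ℂ[X]).eval z‖ ≤ ‖z‖ ^ k * mu p k ‖z‖ := by
  rw [pow_mul_mu p k (norm_ne_zero_iff.2 hz), eval_finsetSum]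
  refine (norm_sum_le _ _).trans_eq (Finset.sum_congr rfl fun i _ => ?_)
  simp

lemma degree_X_pow_mul {q : ℂ[X]} (hq : q.Monic) {k n : ℕ} (h : k + q.natDegree = n) :
    (X ^ k * q).degree = (n : WithBot ℕ) := by
  rw [degree_eq_natDegree ((monic_X_pow k).mul hq).ne_zero, (monic_X_pow k).natDegree_mul hq,
    natDegree_X_pow, h]

lemma monic_assocPoly_add_C {p : ℂ[X]} (hp : p.Monic) {j : ℕ} (hj : 1 ≤ j)
    (hjn : j ≤ p.natDegree) (a : ℂ) : (assocPoly p j + C a).Monic := by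
  refine (monic_assocPoly hp hj hjn).add_of_left (degree_C_le.trans_lt ?_)
  rw [← natDegree_pos_iff_degree_pos, natDegree_assocPoly hp hj hjn]
  exact hj

end GenCauchy

theorem theorem3p2 (n k : ℕ) (hn : 3 ≤ n) (hk : 1 ≤ k) (hkn : k ≤ n - 1)
    (p : ℂ[X]) (hp : p.Monic) (hdeg : p.natDegree = n) (h0 : p.coeff 0 ≠ 0) :
    -- each `h_j` has a unique positive root
    (∀ j < n, ∃! x : ℝ, 0 < x ∧ cauchyFun p j x = 0) ∧
    -- and, for `s_j` that root:
    ∀ s : ℕ → ℝ, (∀ j < n, 0 < s j ∧ cauchyFun p j (s j) = 0) →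
      -- the two expressions for each of the levels agree
      ((assocModPoly p (n - k)).eval (s k) = mu p k (s k) + ‖p.coeff k‖ ∧
        mu p k (s (k - 1)) = (assocModPoly p (n - k)).eval (s (k - 1)) + ‖p.coeff k‖) ∧
      -- all zeros lie in both sets
      (∀ z : ℂ, p.IsRoot z → z ∈ upsilonOne p k (s k) ∧ z ∈ upsilonTwo p k (s (k - 1))) ∧
      -- both sets are closed interiors of lemniscates
      IsClosedInteriorOfLemniscate (upsilonOne p k (s k))
        (assocPoly p (n - k)) ((assocModPoly p (n - k)).eval (s k)) ∧
      IsClosedInteriorOfLemniscate (upsilonTwo p k (s (k - 1)))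
        (assocPoly p (n - k) + C (p.coeff k)) (mu p k (s (k - 1))) ∧
      -- zeros and foci in the components of the first set that are bounded by a Jordan curve
      (∀ R : Set ℂ, IsComponentOf R (upsilonOne p k (s k)) → IsJordanCurve (frontier R) →
        ((0 : ℂ) ∉ R → numZerosIn p R = numZerosIn (assocPoly p (n - k)) R) ∧
        ((0 : ℂ) ∈ R → numZerosIn p R = numZerosIn (assocPoly p (n - k)) R + k)) ∧
      -- the same for the second set
      (∀ R : Set ℂ, IsComponentOf R (upsilonTwo p k (s (k - 1))) → IsJordanCurve (frontier R) →
        ((0 : ℂ) ∉ R →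
          numZerosIn p R = numZerosIn (assocPoly p (n - k) + C (p.coeff k)) R) ∧
        ((0 : ℂ) ∈ R →
          numZerosIn p R = numZerosIn (assocPoly p (n - k) + C (p.coeff k)) R + k)) ∧
      -- the first set for `k = n - 1` is the disk of Cauchy's bound
      ((∀ x : ℝ, cauchyFun p (n - 1) x = x ^ n - ∑ i ∈ Finset.range n, ‖p.coeff i‖ * x ^ i) ∧
        upsilonOne p (n - 1) (s (n - 1)) = Metric.closedBall 0 (s (n - 1)) ∧
        ∀ z : ℂ, p.IsRoot z → ‖z‖ ≤ s (n - 1)) := by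
  subst hdeg
  have hk' : k < p.natDegree := by omega
  refine ⟨fun j hj => existsUnique_pos_cauchyFun_eq_zero hp h0 hj, fun s hs => ?_⟩
  -- Proved for every `j`, because Cauchy's disk needs `j = n - 1` as well as `j = k`.
  have level₁ : ∀ j, j < p.natDegree →
      (assocModPoly p (p.natDegree - j)).eval (s j) = mu p j (s j) + ‖p.coeff j‖ := by
    intro j hj
    obtain ⟨hpos, h⟩ := hs j hj
    rw [cauchyFun_eq hp hj hpos.ne', mul_eq_zero, or_iff_right (pow_pos hpos _).ne'] at h
    linarith
  obtain ⟨hpos, hroot⟩ := hs (k - 1) (by omega)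
  have level₂ : mu p k (s (k - 1)) =
      (assocModPoly p (p.natDegree - k)).eval (s (k - 1)) + ‖p.coeff k‖ := by
    rw [cauchyFun_pred_eq hp hk hk' hpos.ne', mul_eq_zero, or_iff_right (pow_pos hpos _).ne']
      at hroot
    linarith
  have inner₁ : ∀ j, j < p.natDegree → ∀ z : ℂ, ‖z‖ ≤ s j →
      ‖(assocPoly p (p.natDegree - j)).eval z‖ ≤
        (assocModPoly p (p.natDegree - j)).eval (s j) := fun j _ z hz =>
    (norm_eval_le_eval_modulusPoly _ z).trans (eval_modulusPoly_mono _ (norm_nonneg z) hz)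
  have outer₁ : ∀ j, j < p.natDegree → ∀ z : ℂ, s j ≤ ‖z‖ →
      ‖(∑ i ∈ Finset.range (j + 1), C (p.coeff i) * X ^ i : ℂ[X]).eval z‖ ≤
        ‖z‖ ^ j * (assocModPoly p (p.natDegree - j)).eval (s j) := by
    intro j hj z hz
    have hsj := (hs j hj).1
    have hz0 : z ≠ 0 := norm_pos_iff.1 (hsj.trans_le hz)
    rw [Finset.sum_range_succ, eval_add, level₁ j hj, mul_add]
    refine (norm_add_le _ _).trans (add_le_add ?_ ?_)
    · exact (norm_eval_sum_range_le p j hz0).trans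
        (mul_le_mul_of_nonneg_left (mu_anti p j hsj hz) (by positivity))
    · rw [eval_mul, eval_C, eval_pow, eval_X, norm_mul, norm_pow, mul_comm]
  have inner₂ : ∀ z : ℂ, ‖z‖ ≤ s (k - 1) →
      ‖(assocPoly p (p.natDegree - k) + C (p.coeff k)).eval z‖ ≤ mu p k (s (k - 1)) := by
    intro z hz
    rw [eval_add, eval_C, level₂]
    exact (norm_add_le _ _).trans (add_le_add_left ((norm_eval_le_eval_modulusPoly _ z).trans
      (eval_modulusPoly_mono _ (norm_nonneg z) hz)) _)
  have outer₂ : ∀ z : ℂ, s (k - 1) ≤ ‖z‖ →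
      ‖(∑ i ∈ Finset.range k, C (p.coeff i) * X ^ i : ℂ[X]).eval z‖ ≤
        ‖z‖ ^ k * mu p k (s (k - 1)) := fun z hz =>
    (norm_eval_sum_range_le p k (norm_pos_iff.1 (hpos.trans_le hz))).trans
      (mul_le_mul_of_nonneg_left (mu_anti p k hpos hz) (by positivity))
  have split₁ : ∀ j, j < p.natDegree → X ^ j * assocPoly p (p.natDegree - j) +
      ∑ i ∈ Finset.range (j + 1), C (p.coeff i) * X ^ i = p := fun j hj =>
    (eq_X_pow_mul_assocPoly_add hp hj).symm
  -- Here `a_k z^k` belongs to the main part, so the foci are the zeros of `p_{n-k} + a_k`.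
  have split₂ : X ^ k * (assocPoly p (p.natDegree - k) + C (p.coeff k)) +
      ∑ i ∈ Finset.range k, C (p.coeff i) * X ^ i = p := by
    conv_rhs => rw [eq_X_pow_mul_assocPoly_add hp hk', Finset.sum_range_succ]
    ring
  have roots₁ : ∀ j, j < p.natDegree → ∀ z, p.IsRoot z → z ∈ upsilonOne p j (s j) := by
    intro j hj z hz
    refine norm_eval_le_of_isRoot (hs j hj).1 (inner₁ j hj) (outer₁ j hj)
      (Set.right_mem_Icc.2 zero_le_one) ?_
    rwa [Complex.ofReal_one, C_1, one_mul, split₁ j hj]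
  have roots₂ : ∀ z, p.IsRoot z → z ∈ upsilonTwo p k (s (k - 1)) := by
    intro z hz
    have := norm_eval_le_of_isRoot hpos inner₂ outer₂ (Set.right_mem_Icc.2 zero_le_one) (z := z)
      (by rwa [Complex.ofReal_one, C_1, one_mul, split₂])
    rwa [eval_add, eval_C] at this
  have upsilonTwo_eq : upsilonTwo p k (s (k - 1)) =
      {z | ‖(assocPoly p (p.natDegree - k) + C (p.coeff k)).eval z‖ ≤ mu p k (s (k - 1))} := by
    simp only [eval_add, eval_C]
    rfl
  have hj : 1 ≤ p.natDegree - k := by omega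
  have hjn : p.natDegree - k ≤ p.natDegree := Nat.sub_le _ _
  have monic₁ := monic_assocPoly hp hj hjn
  have monic₂ := monic_assocPoly_add_C hp hj hjn (p.coeff k)
  have deg₁ := natDegree_assocPoly hp hj hjn
  have deg₂ : (assocPoly p (p.natDegree - k) + C (p.coeff k)).natDegree = p.natDegree - k := by
    rw [natDegree_add_C, deg₁]
  refine ⟨⟨level₁ k hk', level₂⟩, fun z hz => ⟨roots₁ k hk' z hz, roots₂ z hz⟩, ?_, ?_, ?_, ?_,
    ?_, ?_, ?_⟩
  · exact isClosedInteriorOfLemniscate_norm_eval_le (by omega)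
      (eval_modulusPoly_pos monic₁.ne_zero (hs k hk').1)
  · rw [upsilonTwo_eq]
    exact isClosedInteriorOfLemniscate_norm_eval_le (by omega) (mu_pos h0 hk hpos)
  · intro R hR _
    have := numZerosIn_component (hs k hk').1 monic₁ (by omega)
      ((degree_sum_range_lt p.coeff (k := k + 1) hk').trans_eq
        (degree_X_pow_mul monic₁ (n := p.natDegree) (by omega)).symm)
      (inner₁ k hk') (outer₁ k hk') hR
    rwa [split₁ k hk'] at this
  · intro R hR _
    rw [upsilonTwo_eq] at hR
    have := numZerosIn_component hpos monic₂ (by omega)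
      ((degree_sum_range_lt p.coeff hk'.le).trans_eq
        (degree_X_pow_mul monic₂ (n := p.natDegree) (by omega)).symm)
      inner₂ outer₂ hR
    rwa [split₂] at this
  · intro x
    have h1 : Finset.Ioo (p.natDegree - 1) p.natDegree = ∅ := by
      ext i
      simp
      omega
    rw [cauchyFun, h1, Finset.sum_empty, add_zero, Nat.sub_add_cancel (by omega)]
  all_goals
    -- For `k = n - 1` the associated polynomial is `X`, so the lemniscate is a circle.
    have disk : upsilonOne p (p.natDegree - 1) (s (p.natDegree - 1)) =
        Metric.closedBall 0 (s (p.natDegree - 1)) := by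
      ext z
      rw [mem_closedBall_zero_iff, upsilonOne, Set.mem_ofPred_eq, assocModPoly,
        eval_modulusPoly, Nat.sub_sub_self (by omega)]
      simp [assocPoly, Finset.sum_range_succ]
  · exact disk
  · intro z hz
    have := roots₁ (p.natDegree - 1) (by omega) z hz
    rwa [disk, mem_closedBall_zero_iff] at this
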